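/- Let $\Lambda$ be the commutative rig (semiring) of symmetric functions with coefficients in $\mathbb{N}$, that is, of formal power series in $x_1,x_2,\dots$ over $\mathbb{N}$ of bounded degree that are invariant under all permutations of the variables; let $m_\lambda\in\Lambda$ be the monomial symmetric function of the partition $\lambda$. For $g,f\in\Lambda$ let $g\circ f$ denote plethysm: if $f=y_1+y_2+\cdots$ is the expression of $f$ as a sum of monomials with coefficient $1$ (repeated according to multiplicity), then $g\circ f=g(y_1,y_2,\dots)$. Let $\mathbb{L}$ be the commutative rig $[0,\infty]$ with addition $\min$ and multiplication $+$, ordered by $x\le_{\mathbb{L}}y:\Leftrightarrow y\le x$, and let $\mathbb{W}(\mathbb{L})$ be the set of rig homomorphisms $\Lambda\to\mathbb{L}$. It is ordered by $a\le_{\mathbb{W}(\mathbb{L})} b:\Leftrightarrow a(m_\lambda)\le_{\mathbb{L}}b(m_\lambda)$ for all partitions $\lambda$ of positive integers, and has the multiplication $(a\otimes b)(\varphi)=\bigl(\cdot_{\mathbb{L}}\circ(a\otimes b)\bigr)(\Delta^{\times}\varphi)$, where $\Delta^{\times}:\Lambda\to\Lambda\otimes_{\mathbb{N}}\Lambda$,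 $\Delta^\times(\varphi)=\varphi(\dots,x_i\otimes x_j,\dots)$, with unit $\overline{0}:\Lambda\to\mathbb{L}$ the composite of $\varphi\mapsto\varphi(1,0,0,\dots)\in\mathbb{N}$ with the rig homomorphism $\mathbb{N}\to\mathbb{L}$. A $\mathbb{W}(\mathbb{L})$-category $(X,d)$ is a set $X$ with a map $d:X\times X\to\mathbb{W}(\mathbb{L})$ such that $\overline{0}\le_{\mathbb{W}(\mathbb{L})}d(x,x)$ and $d(x,y)\otimes d(y,z)\le_{\mathbb{W}(\mathbb{L})}d(x,z)$ for all $x,y,z\in X$. For $f\in\Lambda$ put $d_f(x,y)=d(x,y)(f)\in[0,\infty]$. Let $(X,d)$ be a $\mathbb{W}(\mathbb{L})$-category, and let $|X|=\{(X,d_f)\}_{f\in\Lambda}$ be the family indexed by $\Lambda$ (members with different indices are different members, even if the distances agree), with the rig structure $(X,d_f)\oplus(X,d_{f'})=(X,d_{f+f'})$, $(X,d_f)\otimes(X,d_{f'})=(X,d_{f\cdot f'})$, zero $(X,d_0)$ and one $(X,d_1)$. Let $\operatorname{End}(|X|)$ be the rig of all maps $|X|\to|X|$ with pointwise operations. **Proposition.**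 The map $$\Lambda\to\operatorname{End}(|X|),\qquad g\mapsto\bigl((X,d_f)\mapsto(X,d_{g\circ f})\bigr)$$ is a rig homomorphism. (That is, there is exactly one rig homomorphism $\Phi:\Lambda\to\operatorname{End}(|X|)$ with $\Phi(g)(X,d_f)=(X,d_{g\circ f})$ for all $g,f\in\Lambda$.) -/

import Mathlib

noncomputable section

namespace WittLawvere

open scoped ENNReal TensorProduct

/-! ### The rig of symmetric functions with coefficients in `ℕ` -/

/-- The multiset of nonzero exponents of a monomial `n` in variables indexed by `A`. -/
def shape {A : Type*} (n : A →₀ ℕ) : Multiset ℕ := n.support.val.map n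

/-- The exponent vector of `x₀ ^ s₀ * x₁ ^ s₁ * ⋯`, where `s₀ ≥ s₁ ≥ ⋯` are the elements
of the multiset `s`. -/
def exponents (s : Multiset ℕ) : ℕ →₀ ℕ := (s.sort (· ≥ ·)).toFinsupp

theorem shape_equivMapDomain {A B : Type*} (e : A ≃ B) (n : A →₀ ℕ) :
    shape (n.equivMapDomain e) = shape n := by
  classical
  have h : (n.equivMapDomain e).support = n.support.map e.toEmbedding := by
    ext b
    simp [Finset.mem_map_equiv]
  unfold shape
  rw [h]
  simp [Finset.map_val, Multiset.map_map, Function.comp_def]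

theorem sum_shape {A : Type*} (n : A →₀ ℕ) : (shape n).sum = n.degree := rfl

theorem degree_equivMapDomain {A B : Type*} (e : A ≃ B) (n : A →₀ ℕ) :
    (n.equivMapDomain e).degree = n.degree := by
  rw [← sum_shape, ← sum_shape, shape_equivMapDomain]

theorem degree_toFinsupp (l : List ℕ) : l.toFinsupp.degree = l.sum := by
  induction l with
  | nil => rw [List.toFinsupp_nil]; simp
  | cons a l ih =>
    rw [List.toFinsupp_cons_eq_single_add_embDomain, map_add, Finsupp.degree_single,
      Finsupp.embDomain_eq_mapDomain, Finsupp.degree_mapDomain, ih, List.sum_cons]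

theorem degree_exponents (s : Multiset ℕ) : (exponents s).degree = s.sum := by
  rw [exponents, degree_toFinsupp, ← Multiset.sum_coe, Multiset.sort_eq]

/-- The commutative rig of symmetric functions with coefficients in `ℕ`: the formal power series
in `x₀, x₁, x₂, …` over `ℕ` of bounded degree that are invariant under all permutations of the
variables. -/
def symmetricFunctions : Subsemiring (MvPowerSeries ℕ ℕ) where
  carrier := {φ | (∀ (σ : Equiv.Perm ℕ) (m : ℕ →₀ ℕ),
      MvPowerSeries.coeff (m.equivMapDomain σ) φ = MvPowerSeries.coeff m φ) ∧
    ∃ N : ℕ, ∀ m : ℕ →₀ ℕ, N < m.degree → MvPowerSeries.coeff m φ = 0}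
  mul_mem' := by
    classical
    rintro φ ψ ⟨hφ, N, hN⟩ ⟨hψ, M, hM⟩
    refine ⟨fun σ m => ?_, N + M, fun m hm => ?_⟩
    · rw [MvPowerSeries.coeff_mul, MvPowerSeries.coeff_mul]
      symm
      refine Finset.sum_bij'
        (fun p _ => (p.1.equivMapDomain σ, p.2.equivMapDomain σ))
        (fun p _ => (p.1.equivMapDomain σ.symm, p.2.equivMapDomain σ.symm)) ?_ ?_ ?_ ?_ ?_
      · rintro ⟨a, b⟩ h
        rw [Finset.HasAntidiagonal.mem_antidiagonal] at h ⊢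
        rw [← h]
        ext i
        simp
      · rintro ⟨a, b⟩ h
        rw [Finset.HasAntidiagonal.mem_antidiagonal] at h ⊢
        ext i
        have := DFunLike.congr_fun h (σ i)
        simpa using this
      · rintro ⟨a, b⟩ _
        ext i <;> simp
      · rintro ⟨a, b⟩ _
        ext i <;> simp
      · rintro ⟨a, b⟩ _
        simp only [hφ, hψ]
    · rw [MvPowerSeries.coeff_mul]
      refine Finset.sum_eq_zero ?_
      rintro ⟨a, b⟩ h
      rw [Finset.HasAntidiagonal.mem_antidiagonal] at h
      have hd : a.degree + b.degree = m.degree := by rw [← map_add, h]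
      rcases lt_or_ge N a.degree with ha | ha
      · rw [hN a ha, zero_mul]
      · rw [hM b (by omega), mul_zero]
  one_mem' := by
    classical
    refine ⟨fun σ m => ?_, 0, fun m hm => ?_⟩
    · rw [MvPowerSeries.coeff_one, MvPowerSeries.coeff_one]
      refine if_congr ?_ rfl rfl
      rw [← Finsupp.degree_eq_zero_iff, degree_equivMapDomain, Finsupp.degree_eq_zero_iff]
    · rw [MvPowerSeries.coeff_one, if_neg]
      rintro rfl
      simp at hm
  add_mem' := by
    rintro φ ψ ⟨hφ, N, hN⟩ ⟨hψ, M, hM⟩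
    refine ⟨fun σ m => ?_, max N M, fun m hm => ?_⟩
    · rw [map_add, map_add, hφ, hψ]
    · rw [map_add, hN m (lt_of_le_of_lt (le_max_left _ _) hm),
        hM m (lt_of_le_of_lt (le_max_right _ _) hm)]
  zero_mem' := ⟨fun _ _ => by simp, 0, fun _ _ => by simp⟩

/-- The rig `Λ`. -/
abbrev SymmFun : Type := symmetricFunctions

/-- The monomial symmetric function `m_λ`: the sum of all monomials whose multiset of nonzero
exponents is the multiset of parts of `λ`. -/
def msymm {k : ℕ} (lam : k.Partition) : SymmFun :=
  ⟨fun m => open Classical in if shape m = lam.parts then 1 else 0, by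
    classical
    refine ⟨fun σ m => ?_, k, fun m hm => ?_⟩
    · change (if _ then 1 else 0) = (if _ then 1 else 0)
      rw [shape_equivMapDomain]
    · change (if _ then 1 else 0) = 0
      rw [if_neg]
      intro h
      rw [← sum_shape, h, lam.parts_sum] at hm
      exact lt_irrefl _ hm⟩

/-- The coefficient of the monomial `n` in the symmetric function `φ`, evaluated at an arbitrary
set `A` of variables. -/
def coeffAt {A : Type*} (φ : SymmFun) (n : A →₀ ℕ) : ℕ :=
  MvPowerSeries.coeff (exponents (shape n)) (φ : MvPowerSeries ℕ ℕ)

/-- For a family `y` of monomials (elements of an additive monoid `M` of exponents), the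
coefficient of the monomial `m` in `φ(y)`, the series that is obtained from `φ` by replacing its
variables with the members of `y`. In every use below only finitely many `n` contribute. -/
def substCoeff {A M : Type*} [AddCommMonoid M] (φ : SymmFun) (y : A → M) (m : M) : ℕ :=
  ∑ᶠ (n : A →₀ ℕ) (_ : n.sum (fun a k => k • y a) = m), coeffAt φ n

/-! ### Plethysm -/

/-- The monomials of `f`, each repeated according to its coefficient: if `f = ∑ y_i` is the
expression of `f` as a sum of monomials with coefficient `1`, this is the set of indices `i`. -/
abbrev Terms (f : SymmFun) : Type :=
  Σ m : ℕ →₀ ℕ, Fin (MvPowerSeries.coeff m (f : MvPowerSeries ℕ ℕ))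

/-- A permutation of the variables permutes the monomials of a symmetric function. -/
def permTerms (f : SymmFun) (σ : Equiv.Perm ℕ) : Terms f ≃ Terms f where
  toFun t := ⟨t.1.equivMapDomain σ, Fin.cast (f.2.1 σ t.1).symm t.2⟩
  invFun t := ⟨t.1.equivMapDomain σ.symm, Fin.cast (f.2.1 σ.symm t.1).symm t.2⟩
  left_inv t := by
    obtain ⟨m, i⟩ := t
    have h : (m.equivMapDomain σ).equivMapDomain σ.symm = m := by ext; simp
    refine Sigma.ext h ?_
    exact (Fin.heq_ext_iff (by dsimp only; rw [h])).2 rfl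
  right_inv t := by
    obtain ⟨m, i⟩ := t
    have h : (m.equivMapDomain σ.symm).equivMapDomain σ = m := by ext; simp
    refine Sigma.ext h ?_
    exact (Fin.heq_ext_iff (by dsimp only; rw [h])).2 rfl

theorem coeffAt_equivMapDomain {A B : Type*} (φ : SymmFun) (e : A ≃ B) (n : A →₀ ℕ) :
    coeffAt φ (n.equivMapDomain e) = coeffAt φ n := by
  rw [coeffAt, coeffAt, shape_equivMapDomain]

theorem substCoeff_perm (g f : SymmFun) (σ : Equiv.Perm ℕ) (m : ℕ →₀ ℕ) :
    substCoeff g (fun t : Terms f => t.1) (m.equivMapDomain σ) =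
      substCoeff g (fun t : Terms f => t.1) m := by
  unfold substCoeff
  let E : (Terms f →₀ ℕ) ≃ (Terms f →₀ ℕ) :=
    Finsupp.equivCongrLeft (permTerms f σ)
  rw [← finsum_comp_equiv E]
  have hE : ∀ n, E n = n.equivMapDomain (permTerms f σ) := fun n => rfl
  refine finsum_congr fun n => ?_
  have hinj : Function.Injective (fun a : ℕ →₀ ℕ => a.equivMapDomain σ) :=
    (Finsupp.equivCongrLeft σ).injective
  have hsum : (E n).sum (fun t k => k • t.1) =
      (n.sum (fun t k => k • t.1)).equivMapDomain σ := by
    have h1 : (E n).sum (fun t k => k • t.1) =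
        n.sum (fun t k => k • t.1.equivMapDomain σ) := by
      rw [hE, Finsupp.equivMapDomain_eq_mapDomain, Finsupp.sum_mapDomain_index (by simp) (by intros; rw [add_smul])]
      rfl
    rw [h1, Finsupp.equivMapDomain_eq_mapDomain, ← Finsupp.mapDomain.addMonoidHom_apply,
      map_finsuppSum]
    refine Finsupp.sum_congr fun t _ => ?_
    rw [map_nsmul, Finsupp.mapDomain.addMonoidHom_apply, Finsupp.equivMapDomain_eq_mapDomain]
  have hc : coeffAt g (E n) = coeffAt g n := by rw [hE, coeffAt_equivMapDomain]
  rw [hc, hsum]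
  exact finsum_congr_Prop (propext hinj.eq_iff) fun _ => rfl

theorem exists_degree_bound (g f : SymmFun) : ∃ N : ℕ, ∀ m : ℕ →₀ ℕ, N < m.degree →
    substCoeff g (fun t : Terms f => t.1) m = 0 := by
  obtain ⟨N, hN⟩ := g.2.2
  obtain ⟨M, hM⟩ := f.2.2
  refine ⟨N * M, fun m hm => ?_⟩
  unfold substCoeff
  refine finsum_eq_zero_of_forall_eq_zero fun n => ?_
  by_cases hn : n.sum (fun t k => k • t.1) = m
  swap
  · simp [hn]
  rw [finsum_eq_if, if_pos hn]
  refine hN _ ?_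
  rw [degree_exponents, sum_shape]
  by_contra hlt
  push Not at hlt
  have hdeg : ∀ t : Terms f, t.1.degree ≤ M := by
    intro t
    by_contra ht
    push Not at ht
    have h0 := hM t.1 ht
    exact absurd (lt_of_lt_of_eq t.2.2 h0) (Nat.not_lt_zero _)
  have : m.degree ≤ n.degree * M := by
    rw [← hn, Finsupp.sum, map_sum, Finsupp.degree_apply, Finset.sum_mul]
    refine Finset.sum_le_sum fun t _ => ?_
    rw [map_nsmul, smul_eq_mul]
    exact Nat.mul_le_mul_left _ (hdeg t)
  have h2 := Nat.mul_le_mul_right M hlt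
  omega

/-- The plethysm `g ∘ f = g(y₀, y₁, y₂, …)`, where `f = y₀ + y₁ + y₂ + ⋯` is the expression of `f`
as a sum of monomials with coefficient `1`. -/
def plethysm (g f : SymmFun) : SymmFun :=
  ⟨fun m => substCoeff g (fun t : Terms f => t.1) m,
    fun σ m => substCoeff_perm g f σ m, exists_degree_bound g f⟩

/-! ### Witt vectors in the Lawvere quantale -/

/-- The Lawvere quantale as a commutative rig: the set `[0, ∞]` with addition `min` (whose neutral
element is `∞`) and multiplication `+` (whose neutral element is `0`). -/
abbrev Law : Type := Tropical ℝ≥0∞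

/-- The order of the Lawvere quantale, opposite to the usual order of `[0, ∞]`. -/
def Law.le (x y : Law) : Prop := Tropical.untrop y ≤ Tropical.untrop x

/-- The underlying set of the rig of Witt vectors in the Lawvere quantale: rig homomorphisms. -/
abbrev Witt : Type := SymmFun →+* Law

/-- Comultiplication `Δ^×(φ) = φ(…, x_i ⊗ x_j, …)`, expanded in the basis `m_μ ⊗ m_ν`: the
coefficient of `m_μ ⊗ m_ν` is the coefficient of `x^μ ⊗ x^ν` in `φ(…, x_i ⊗ x_j, …)`. A monomial
in the variables `x_i ⊗ 1` and `1 ⊗ x_j` is a pair of exponent vectors. -/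
def comul (φ : SymmFun) : SymmFun ⊗[ℕ] SymmFun :=
  ∑ᶠ p : (Σ k : ℕ, k.Partition) × (Σ k : ℕ, k.Partition),
    substCoeff φ
        (fun ij : ℕ × ℕ => ((Finsupp.single ij.1 1, Finsupp.single ij.2 1) :
          (ℕ →₀ ℕ) × (ℕ →₀ ℕ)))
        (exponents p.1.2.parts, exponents p.2.2.parts) •
      (msymm p.1.2 ⊗ₜ[ℕ] msymm p.2.2)

/-- Co-multiplicative unit `ε^×(φ) = φ(1, 0, 0, …)`. -/
def counit (φ : SymmFun) : ℕ :=
  ∑ᶠ k : ℕ, MvPowerSeries.coeff (Finsupp.single 0 k) (φ : MvPowerSeries ℕ ℕ)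

/-- The product of the rig of Witt vectors: the composite of `Δ^×`, of `a ⊗ b` and of the
multiplication of the Lawvere quantale. -/
def wittMul (a b : Witt) : SymmFun → Law := fun φ =>
  Algebra.TensorProduct.productMap a.toNatAlgHom b.toNatAlgHom (comul φ)

/-- The multiplicative unit of the rig of Witt vectors: `ε^×` followed by `ℕ → [0, ∞]`. -/
def wittOne : SymmFun → Law := fun φ => (counit φ : Law)

/-- The order on Witt vectors: comparison on all `m_λ`, for `λ` a partition of some `k > 0`. -/
def wittLe (a b : SymmFun → Law) : Prop :=
  ∀ (k : ℕ), 0 < k → ∀ lam : k.Partition, Law.le (a (msymm lam)) (b (msymm lam))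

/-- A category enriched over the monoidal poset of Witt vectors in the Lawvere quantale, with set
of objects `X`. -/
structure WittCategory (X : Type*) where
  /-- the hom-map -/
  d : X → X → Witt
  /-- identity axiom -/
  one_le : ∀ x, wittLe wittOne (d x x)
  /-- composition axiom -/
  mul_le : ∀ x y z, wittLe (wittMul (d x y) (d y z)) (d x z)

namespace WittCategory

variable {X : Type*} (C : WittCategory X)

/-- The observed distance `d_f(x, y) = d(x, y)(f)`. -/
def distAt (f : SymmFun) : X → X → Law := fun x y => C.d x y f

/-- The indexed family `|X|` of the spaces `(X, d_f)`, `f ∈ Λ`: an element consists of an index `f`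
and of the distance `d_f` at that index. -/
@[ext]
structure Family where
  /-- the index -/
  index : SymmFun
  /-- the distance on the set of objects -/
  dist : X → X → Law
  /-- the distance is the one that belongs to the index -/
  dist_eq : dist = C.distAt index

/-- The member `(X, d_f)` of the family. -/
def space (f : SymmFun) : C.Family := ⟨f, C.distAt f, rfl⟩

namespace Family

variable {C}

theorem index_injective : Function.Injective (Family.index : C.Family → SymmFun) := by
  rintro ⟨f, d, rfl⟩ ⟨g, e, rfl⟩ h
  cases h
  rfl

/-- `(X, d_f) ⊕ (X, d_g) = (X, d_{f + g})`. -/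
instance : Add C.Family := ⟨fun a b => C.space (a.index + b.index)⟩

/-- `(X, d_f) ⊗ (X, d_g) = (X, d_{f * g})`. -/
instance : Mul C.Family := ⟨fun a b => C.space (a.index * b.index)⟩

instance : Zero C.Family := ⟨C.space 0⟩

instance : One C.Family := ⟨C.space 1⟩

instance : SMul ℕ C.Family := ⟨fun n a => C.space (n • a.index)⟩

instance : Pow C.Family ℕ := ⟨fun a n => C.space (a.index ^ n)⟩

instance : NatCast C.Family := ⟨fun n => C.space n⟩

/-- The rig structure of the family. -/
instance : CommSemiring C.Family :=
  Function.Injective.commSemiring Family.index index_injective rfl rfl (fun _ _ => rfl)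
    (fun _ _ => rfl) (fun _ _ => rfl) (fun _ _ => rfl) (fun _ => rfl)

end Family

/-- The rig `End(|X|)` of all maps from the family to itself, with pointwise operations. -/
abbrev EndFamily : Type _ := C.Family → C.Family

end WittCategory

end WittLawvere

end

namespace WittLawvere

open Finset

/-! For fixed `f = y₀ + y₁ + ⋯`, the map `g ↦ g(y₀, y₁, …)` is a substitution, hence compatible with
`0`, `1`, `+` and `*`. Operations on `EndFamily` are pointwise, and those of the family are carried
by the index, so these four identities give the homomorphism. It is unique because every member of
the family is `C.space f` for some `f`. The work lies in the product, where two facts are needed.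
Coefficients of symmetric functions obey the Cauchy product rule in any set of variables, here
`Terms f` (`coeffAt_mul`). Only finitely many exponent vectors contribute to a given monomial
(`finite_sum_le`), so the sums may be regrouped (`substCoeff_mul`). -/

/-! ### Coefficients in an arbitrary set of variables -/

theorem count_shape {A : Type*} (n : A →₀ ℕ) {c : ℕ} (hc : c ≠ 0) :
    (shape n).count c = Nat.card {a // n a = c} := by
  classical
  rw [shape, Multiset.count_map, ← Finset.filter_val, Finset.card_val, Nat.subtype_card]
  intro a
  simp only [mem_filter, Finsupp.mem_support_iff]
  exact ⟨fun h => h.2.symm, fun h => ⟨h ▸ hc, h.symm⟩⟩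

theorem shape_toFinsupp {l : List ℕ} (hl : 0 ∉ l) : shape l.toFinsupp = (l : Multiset ℕ) := by
  have hs : l.toFinsupp.support = range l.length := by
    rw [List.toFinsupp_support, filter_eq_self]
    intro i hi h
    rw [mem_range] at hi
    rw [List.getD_eq_getElem _ _ hi] at h
    exact hl (h ▸ List.getElem_mem hi)
  rw [shape, hs]
  refine congrArg _ (List.ext_getElem (by simp) fun i h₁ h₂ => ?_)
  simp [h₂]

theorem shape_exponents_shape {A : Type*} (n : A →₀ ℕ) : shape (exponents (shape n)) = shape n := by
  rw [exponents, shape_toFinsupp, Multiset.sort_eq]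
  simp [shape]

/-- Bijections between the level sets of `m` and `n` glue to a permutation. For a nonzero value the
level sets are finite, with size read off from the shape; for the value `0` both are countably
infinite. -/
theorem exists_perm_of_shape_eq {m n : ℕ →₀ ℕ} (h : shape m = shape n) :
    ∃ σ : Equiv.Perm ℕ, m.equivMapDomain σ = n := by
  have hinf : ∀ r : ℕ →₀ ℕ, Infinite {a // r a = 0} := fun r => by
    refine Set.infinite_coe_iff.2 (Set.Infinite.mono ?_ r.support.finite_toSet.infinite_compl)
    intro a ha
    exact not_not.1 fun h => ha (Finsupp.mem_support_iff.2 h)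
  have hfin : ∀ (r : ℕ →₀ ℕ) (c : ℕ), c ≠ 0 → Finite {a // r a = c} := fun r c hc =>
    (r.support.finite_toSet.subset fun a (ha : r a = c) => by simp [ha, hc]).to_subtype
  have key : ∀ c, Nonempty ({a // m a = c} ≃ {a // n a = c}) := fun c => by
    rcases eq_or_ne c 0 with rfl | hc
    · have := hinf m
      have := hinf n
      exact nonempty_equiv_of_countable
    · have := hfin m c hc
      have := hfin n c hc
      exact Finite.card_eq.1 (by rw [← count_shape m hc, ← count_shape n hc, h])
  let σ : Equiv.Perm ℕ := Equiv.ofFiberEquiv fun c => (key c).some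
  refine ⟨σ, Finsupp.ext fun a => ?_⟩
  rw [Finsupp.equivMapDomain_apply]
  have := Equiv.ofFiberEquiv_map (fun c => (key c).some) (σ.symm a)
  rw [← this]
  exact congrArg n (σ.apply_symm_apply a)

/-- `coeffAt` reads the coefficient at the sorted representative, which is a permutation of `m`;
symmetry of `φ` does the rest. -/
theorem coeffAt_nat (φ : SymmFun) (m : ℕ →₀ ℕ) :
    coeffAt φ m = MvPowerSeries.coeff m (φ : MvPowerSeries ℕ ℕ) := by
  obtain ⟨σ, hσ⟩ := exists_perm_of_shape_eq (shape_exponents_shape m).symm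
  rw [coeffAt, ← hσ, φ.2.1]

theorem shape_embDomain {A B : Type*} (i : A ↪ B) (n : A →₀ ℕ) :
    shape (n.embDomain i) = shape n := by
  simp [shape, Finset.map_val, Multiset.map_map]

theorem coeffAt_embDomain {A B : Type*} (φ : SymmFun) (i : A ↪ B) (n : A →₀ ℕ) :
    coeffAt φ (n.embDomain i) = coeffAt φ n := by
  rw [coeffAt, coeffAt, shape_embDomain]

theorem exists_eq_embDomain {A B : Type*} (i : A ↪ B) {n : B →₀ ℕ}
    (h : ∀ b, n b ≠ 0 → b ∈ Set.range i) : ∃ r : A →₀ ℕ, r.embDomain i = n := by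
  classical
  refine ⟨n.comapDomain i i.injective.injOn, Finsupp.ext fun b => ?_⟩
  by_cases hb : b ∈ Set.range i
  · obtain ⟨a, rfl⟩ := hb
    rw [Finsupp.embDomain_apply_self, Finsupp.comapDomain_apply]
  · rw [Finsupp.embDomain_of_notMem_range _ _ _ hb]
    by_contra h0
    exact hb (h b (Ne.symm h0))

/-- Exponents in `ℕ` cannot cancel, so both summands of an embedded vector vanish off the range and
are themselves embedded. -/
theorem sum_antidiagonal_embDomain {A B R : Type*} [DecidableEq A] [DecidableEq B]
    [AddCommMonoid R] (i : A ↪ B) (n : A →₀ ℕ) (F : (B →₀ ℕ) × (B →₀ ℕ) → R) :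
    ∑ p ∈ antidiagonal (n.embDomain i), F p =
      ∑ p ∈ antidiagonal n, F (p.1.embDomain i, p.2.embDomain i) := by
  have hadd : ∀ a b : A →₀ ℕ, (a + b).embDomain i = a.embDomain i + b.embDomain i := fun a b => by
    simp only [Finsupp.embDomain_eq_mapDomain, Finsupp.mapDomain_add]
  symm
  refine sum_bij (fun p _ => (p.1.embDomain i, p.2.embDomain i)) ?_ ?_ ?_ fun _ _ => rfl
  · rintro ⟨a, b⟩ h
    rw [HasAntidiagonal.mem_antidiagonal] at h ⊢
    rw [← h, hadd]
  · rintro ⟨a, b⟩ _ ⟨a', b'⟩ _ h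
    rw [Prod.mk.injEq] at h ⊢
    exact ⟨Finsupp.embDomain_injective i h.1, Finsupp.embDomain_injective i h.2⟩
  · rintro ⟨a, b⟩ h
    rw [HasAntidiagonal.mem_antidiagonal] at h
    have hr : ∀ c, a c + b c ≠ 0 → c ∈ Set.range i := fun c hc => by
      by_contra hc'
      apply hc
      rw [← Finsupp.add_apply, show a + b = _ from h, Finsupp.embDomain_of_notMem_range _ _ _ hc']
    obtain ⟨a, rfl⟩ := exists_eq_embDomain i (n := a) fun c hc => hr c (by omega)
    obtain ⟨b, rfl⟩ := exists_eq_embDomain i (n := b) fun c hc => hr c (by omega)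
    refine ⟨(a, b), ?_, rfl⟩
    rw [HasAntidiagonal.mem_antidiagonal]
    exact Finsupp.embDomain_injective i ((hadd a b).trans h)

/-- The multiplication rule for coefficients, in an arbitrary set of variables. -/
theorem coeffAt_mul {A : Type*} [DecidableEq A] (φ ψ : SymmFun) (n : A →₀ ℕ) :
    coeffAt (φ * ψ) n = ∑ p ∈ antidiagonal n, coeffAt φ p.1 * coeffAt ψ p.2 := by
  -- The finite support embeds both in `A` and in `ℕ`, which transports the product rule for power
  -- series over `ℕ` to `A`.
  let i : n.support ↪ A := Function.Embedding.subtype _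
  let j : n.support ↪ ℕ := n.support.equivFin.toEmbedding.trans Fin.valEmbedding
  obtain ⟨r, hr⟩ := exists_eq_embDomain i (n := n) fun b hb =>
    ⟨⟨b, Finsupp.mem_support_iff.2 hb⟩, rfl⟩
  rw [← hr, coeffAt_embDomain, sum_antidiagonal_embDomain, ← coeffAt_embDomain _ j, coeffAt_nat]
  change MvPowerSeries.coeff _ ((φ : MvPowerSeries ℕ ℕ) * (ψ : MvPowerSeries ℕ ℕ)) = _
  rw [MvPowerSeries.coeff_mul, sum_antidiagonal_embDomain]
  simp only [← coeffAt_nat, coeffAt_embDomain]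

theorem coeffAt_add {A : Type*} (φ ψ : SymmFun) (n : A →₀ ℕ) :
    coeffAt (φ + ψ) n = coeffAt φ n + coeffAt ψ n := rfl

theorem coeffAt_zero {A : Type*} (n : A →₀ ℕ) : coeffAt 0 n = 0 := rfl

theorem coeffAt_one {A : Type*} [DecidableEq A] (n : A →₀ ℕ) :
    coeffAt 1 n = if n = 0 then 1 else 0 := by
  classical
  change MvPowerSeries.coeff _ (1 : MvPowerSeries ℕ ℕ) = _
  rw [MvPowerSeries.coeff_one]
  refine if_congr ?_ rfl rfl
  rw [← Finsupp.degree_eq_zero_iff, degree_exponents, sum_shape, Finsupp.degree_eq_zero_iff]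

theorem exists_coeffAt_eq_zero (φ : SymmFun) : ∃ N : ℕ, ∀ {A : Type} (n : A →₀ ℕ),
    N < n.degree → coeffAt φ n = 0 := by
  obtain ⟨N, hN⟩ := φ.2.2
  exact ⟨N, fun n hn => hN _ (by rwa [degree_exponents, sum_shape])⟩

/-! ### Finiteness and substitution of monomials -/

theorem finite_terms_le (f : SymmFun) (m : ℕ →₀ ℕ) : {t : Terms f | t.1 ≤ m}.Finite := by
  classical
  have : {t : Terms f | t.1 ≤ m} = ((Iic m).sigma fun _ => univ : Finset (Terms f)) := by
    ext t
    simp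
  rw [this]
  exact finite_toSet _

/-- Such `n` live on the finitely many `a` with `y a ≤ m`, with values at most `N`. The degree bound
matters when some `y a = 0`: its exponent is then not controlled by `m`. -/
theorem finite_sum_le {A : Type*} {y : A → ℕ →₀ ℕ} {m : ℕ →₀ ℕ} (hy : {a | y a ≤ m}.Finite)
    (N : ℕ) : {n : A →₀ ℕ | (n.sum fun a k => k • y a) ≤ m ∧ n.degree ≤ N}.Finite := by
  classical
  refine (Set.finite_Iic (Finsupp.indicator hy.toFinset fun _ _ => N)).subset ?_
  rintro n ⟨h₁, h₂⟩ a
  by_cases ha : n a = 0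
  · simp [ha]
  have hle : y a ≤ m := by
    refine le_trans ?_ h₁
    refine le_trans ?_ (single_le_sum (f := fun a => n a • y a) (fun _ _ => zero_le)
      (Finsupp.mem_support_iff.2 ha))
    exact le_self_nsmul zero_le ha
  rw [Finsupp.indicator_of_mem (by simpa using hle)]
  exact (Finsupp.le_degree a n).trans h₂

theorem substCoeff_eq_sum {A : Type*} {φ : SymmFun} {y : A → ℕ →₀ ℕ} {m : ℕ →₀ ℕ}
    (s : Finset (A →₀ ℕ))
    (hs : ∀ n : A →₀ ℕ, (n.sum fun a k => k • y a) = m → coeffAt φ n ≠ 0 → n ∈ s) :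
    substCoeff φ y m = ∑ n ∈ s with (n.sum fun a k => k • y a) = m, coeffAt φ n := by
  rw [substCoeff]
  refine finsum_mem_eq_sum_of_inter_support_eq _ ?_
  ext n
  simp only [Set.mem_inter_iff, Set.mem_ofPred_eq, Function.mem_support, coe_filter]
  exact ⟨fun h => ⟨⟨hs n h.1 h.2, h.1⟩, h.2⟩, fun h => ⟨h.1.2, h.2⟩⟩

theorem substCoeff_add {A : Type} (φ ψ : SymmFun) {y : A → ℕ →₀ ℕ} {m : ℕ →₀ ℕ}
    (hy : {a | y a ≤ m}.Finite) :
    substCoeff (φ + ψ) y m = substCoeff φ y m + substCoeff ψ y m := by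
  obtain ⟨N, hN⟩ := exists_coeffAt_eq_zero φ
  obtain ⟨M, hM⟩ := exists_coeffAt_eq_zero ψ
  let s := (finite_sum_le hy (max N M)).toFinset
  have h₁ : ∀ n : A →₀ ℕ, (n.sum fun a k => k • y a) = m → coeffAt φ n ≠ 0 → n ∈ s :=
    fun n hn h => (Set.Finite.mem_toFinset _).2
      ⟨hn.le, le_max_of_le_left (not_lt.1 (mt (hN n) h))⟩
  have h₂ : ∀ n : A →₀ ℕ, (n.sum fun a k => k • y a) = m → coeffAt ψ n ≠ 0 → n ∈ s :=
    fun n hn h => (Set.Finite.mem_toFinset _).2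
      ⟨hn.le, le_max_of_le_right (not_lt.1 (mt (hM n) h))⟩
  rw [substCoeff_eq_sum s h₁, substCoeff_eq_sum s h₂, substCoeff_eq_sum s, ← sum_add_distrib]
  · rfl
  · intro n hn h
    by_cases h0 : coeffAt φ n = 0
    · exact h₂ n hn fun h' => h (by rw [coeffAt_add, h0, h'])
    · exact h₁ n hn h0

/-- Both sides equal the sum of `F` over the finite set `Q` of pairs of exponent vectors. Grouping
by `q.1 + q.2` gives the left side via `coeffAt_mul`; grouping by `(e q.1, e q.2)` gives the right
side. -/
theorem substCoeff_mul {A : Type} (φ ψ : SymmFun) {y : A → ℕ →₀ ℕ} {m : ℕ →₀ ℕ}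
    (hy : {a | y a ≤ m}.Finite) :
    substCoeff (φ * ψ) y m =
      ∑ p ∈ antidiagonal m, substCoeff φ y p.1 * substCoeff ψ y p.2 := by
  classical
  obtain ⟨N, hN⟩ := exists_coeffAt_eq_zero φ
  obtain ⟨M, hM⟩ := exists_coeffAt_eq_zero ψ
  let e : (A →₀ ℕ) → (ℕ →₀ ℕ) := fun n => n.sum fun a k => k • y a
  have he : ∀ a b, e (a + b) = e a + e b := fun a b =>
    Finsupp.sum_add_index' (by simp) (by intros; rw [add_smul])
  let s := (finite_sum_le hy N).toFinset
  let t := (finite_sum_le hy M).toFinset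
  let u := (finite_sum_le hy (N + M)).toFinset
  -- An inequality rather than `e n = m`, since one `s` must serve every first component of
  -- `antidiagonal m`.
  have hs : ∀ n, e n ≤ m → coeffAt φ n ≠ 0 → n ∈ s := fun n hn h =>
    (Set.Finite.mem_toFinset _).2 ⟨hn, not_lt.1 (mt (hN n) h)⟩
  have ht : ∀ n, e n ≤ m → coeffAt ψ n ≠ 0 → n ∈ t := fun n hn h =>
    (Set.Finite.mem_toFinset _).2 ⟨hn, not_lt.1 (mt (hM n) h)⟩
  have hfst : ∀ a b, e (a + b) = m → e a ≤ m := fun a b h => h ▸ he a b ▸ le_self_add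
  have hsnd : ∀ a b, e (a + b) = m → e b ≤ m := fun a b h => h ▸ he a b ▸ le_add_self
  let Q := {q ∈ s ×ˢ t | e q.1 + e q.2 = m}
  let F : (A →₀ ℕ) × (A →₀ ℕ) → ℕ := fun q => coeffAt φ q.1 * coeffAt ψ q.2
  have hfiber : ∀ n, e n = m → ∑ q ∈ Q with q.1 + q.2 = n, F q = coeffAt (φ * ψ) n := by
    intro n hn
    rw [coeffAt_mul]
    refine sum_subset (fun q hq => HasAntidiagonal.mem_antidiagonal.2 (mem_filter.1 hq).2) fun q hq hq' => ?_
    rw [HasAntidiagonal.mem_antidiagonal] at hq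
    rw [← hq] at hn
    by_contra h0
    refine hq' (mem_filter.2 ⟨mem_filter.2 ⟨mem_product.2 ⟨?_, ?_⟩, (he _ _).symm.trans hn⟩, hq⟩)
    · exact hs _ (hfst _ _ hn) (left_ne_zero_of_mul h0)
    · exact ht _ (hsnd _ _ hn) (right_ne_zero_of_mul h0)
  have hQu : ∀ q ∈ Q, q.1 + q.2 ∈ {n ∈ u | e n = m} := by
    intro q hq
    obtain ⟨hq, hqm⟩ := mem_filter.1 hq
    obtain ⟨h₁, h₂⟩ := mem_product.1 hq
    have h₁ := ((Set.Finite.mem_toFinset _).1 h₁).2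
    have h₂ := ((Set.Finite.mem_toFinset _).1 h₂).2
    have hm := (he q.1 q.2).trans hqm
    refine mem_filter.2 ⟨(Set.Finite.mem_toFinset _).2 ⟨hm.le, ?_⟩, hm⟩
    rw [map_add]
    exact add_le_add h₁ h₂
  have hleft : substCoeff (φ * ψ) y m = ∑ q ∈ Q, F q := by
    rw [substCoeff_eq_sum u, ← sum_fiberwise_of_maps_to hQu]
    · exact sum_congr rfl fun n hn => (hfiber n (mem_filter.1 hn).2).symm
    -- A nonzero coefficient of the product forces a pair of `Q` over `n`, so the degree bound `N +
    -- M` comes from `hQu`.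
    · intro n hn h
      rw [← hfiber n hn] at h
      obtain ⟨q, hq, -⟩ := exists_ne_zero_of_sum_ne_zero h
      obtain ⟨hqQ, rfl⟩ := mem_filter.1 hq
      exact (mem_filter.1 (hQu q hqQ)).1
  have hQm : ∀ q ∈ Q, (e q.1, e q.2) ∈ antidiagonal m := fun q hq =>
    HasAntidiagonal.mem_antidiagonal.2 (mem_filter.1 hq).2
  rw [hleft, ← sum_fiberwise_of_maps_to hQm]
  refine sum_congr rfl fun p hp => ?_
  rw [HasAntidiagonal.mem_antidiagonal] at hp
  have h₁ : p.1 ≤ m := hp ▸ le_self_add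
  have h₂ : p.2 ≤ m := hp ▸ le_add_self
  rw [substCoeff_eq_sum s fun n hn => hs n (hn.trans_le h₁),
    substCoeff_eq_sum t fun n hn => ht n (hn.trans_le h₂), sum_mul_sum, ← sum_product']
  refine sum_congr ?_ fun _ _ => rfl
  ext q
  simp only [Q, mem_filter, mem_product, Prod.ext_iff]
  constructor
  · rintro ⟨⟨⟨h₁, h₂⟩, -⟩, h₃, h₄⟩
    exact ⟨⟨h₁, h₃⟩, h₂, h₄⟩
  · rintro ⟨⟨h₁, h₃⟩, h₂, h₄⟩
    exact ⟨⟨⟨h₁, h₂⟩, by rw [← hp]; exact congrArg₂ _ h₃ h₄⟩, h₃, h₄⟩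

/-! ### Plethysm as a homomorphism in its first argument -/

theorem coeff_plethysm (g f : SymmFun) (m : ℕ →₀ ℕ) :
    MvPowerSeries.coeff m (plethysm g f : MvPowerSeries ℕ ℕ) =
      substCoeff g (fun t : Terms f => t.1) m := rfl

theorem zero_plethysm (f : SymmFun) : plethysm 0 f = 0 := by
  refine Subtype.ext (MvPowerSeries.ext fun m => ?_)
  rw [coeff_plethysm, substCoeff_eq_sum ∅ fun n _ h => absurd (coeffAt_zero n) h]
  simp

theorem one_plethysm (f : SymmFun) : plethysm 1 f = 1 := by
  classical
  refine Subtype.ext (MvPowerSeries.ext fun m => ?_)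
  rw [coeff_plethysm, substCoeff_eq_sum {0} fun n _ h => ?_]
  · change _ = MvPowerSeries.coeff m (1 : MvPowerSeries ℕ ℕ)
    rw [sum_filter, sum_singleton, Finsupp.sum_zero_index, coeffAt_one, if_pos rfl,
      MvPowerSeries.coeff_one]
    exact if_congr eq_comm rfl rfl
  · rw [coeffAt_one] at h
    simpa using h

theorem add_plethysm (g h f : SymmFun) :
    plethysm (g + h) f = plethysm g f + plethysm h f :=
  Subtype.ext (MvPowerSeries.ext fun m => substCoeff_add g h (finite_terms_le f m))

theorem mul_plethysm (g h f : SymmFun) :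
    plethysm (g * h) f = plethysm g f * plethysm h f := by
  classical
  refine Subtype.ext (MvPowerSeries.ext fun m => ?_)
  change _ = MvPowerSeries.coeff m
    ((plethysm g f : MvPowerSeries ℕ ℕ) * (plethysm h f : MvPowerSeries ℕ ℕ))
  rw [MvPowerSeries.coeff_mul]
  exact substCoeff_mul g h (finite_terms_le f m)

/-! ### The action on the family -/

namespace WittCategory

variable {X : Type*} (C : WittCategory X)

theorem space_index (a : C.Family) : C.space a.index = a := Family.index_injective rfl

/-- The action of `Λ` on the family `|X|` by plethysm. -/
noncomputable def plethysmHom : SymmFun →+* C.EndFamily where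
  toFun g a := C.space (plethysm g a.index)
  map_zero' := funext fun a => congrArg C.space (zero_plethysm a.index)
  map_one' := funext fun a => congrArg C.space (one_plethysm a.index)
  map_add' g h := funext fun a => congrArg C.space (add_plethysm g h a.index)
  map_mul' g h := funext fun a => congrArg C.space (mul_plethysm g h a.index)

end WittCategory

end WittLawvere

theorem mainTheorem9 {X : Type*} (C : WittLawvere.WittCategory X) :
    ∃! Φ : WittLawvere.SymmFun →+* C.EndFamily,
      ∀ g f : WittLawvere.SymmFun,
        Φ g (C.space f) = C.space (WittLawvere.plethysm g f) := by
  refine ⟨C.plethysmHom, fun g f => rfl, fun Ψ hΨ => RingHom.ext fun g => funext fun a => ?_⟩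
  rw [← C.space_index a]
  exact hΨ g a.index
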